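/- **Setting.** A coordinator and $k\ge 1$ players track a threshold $N\ge 1$. Items arrive one at a time, each at one player; the coordinator must raise an alarm exactly when the $N$-th item arrives. The communication cost is the number of messages sent or received by the coordinator. Let $\mu_1,\dots,\mu_k\ge 0$ with $\sum_i\mu_i=1$ be known, and let $0<\delta<1$. **Algorithm StcSlk-KwnDst** (a 1-Notification-to-End algorithm). It runs in rounds; at the start of each round all counters $n_i$ (items received by player $i$ in the round) are set to $0$. Let $N$ denote the current remaining threshold and $\beta=2(\sqrt2+\tfrac23)^2$. 1. If $N\le 4k$, run the straightforward algorithm: after one instructing message to each player, each item triggers one message, and the alarm is raised at the $N$-th one. 2. Otherwise, if $N\le \beta k\ln\frac k\delta$, run the CMY algorithm until termination. CMY works in rounds: if $N<4k$, run the straightforward algorithm; otherwise send the slack $s=\lfloor N/(2k)\rfloor$ to every player; a player notifies the coordinator each time its counter has grown by $s$; at the $k$-th notification the coordinator requests and receives all counters, replaces $N$ by $N-\sum_i n_i$, and starts a new CMY round. 3. Otherwise, with $t=N-(\sqrt2+\tfrac23)\sqrt{kN\ln\frac k\delta}$, send to player $i$ the slack $s_i=\mu_i t+\sqrt{2t\mu_i(1-\mu_i)\ln\frac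 k\delta}+\tfrac23\ln\frac k\delta$. Player $i$ notifies the coordinator as soon as $n_i$ reaches $s_i$ (i.e. $n_i\ge s_i$). At the first notification the coordinator requests and receives all counters and replaces $N$ by $N-\sum_i n_i$; if the result is $0$ it raises the alarm, otherwise a new round starts at step 1. Every round of every kind (static-slack, CMY, straightforward) is counted as a round. Logarithms inside $\log\log$ are read as $\max\{1,\log(\cdot)\}$, i.e. $\log\log x:=\max\{1,\ln\max\{1,\ln x\}\}$, so that the bounds are meaningful for all parameters. **Theorem.** There is an absolute constant $C>0$ such that for all $k,N\ge1$, $\delta\in(0,1)$ and $\mu$ as above, the following holds. On every input stream the algorithm raises the alarm exactly at the arrival of the $N$-th item. If, moreover, the items go independently to the players, each to player $i$ with probability $\mu_i$, then with probability at least $1-\delta\cdot C\log\log N$ the algorithm both * runs at most $C\left(\log\log\frac{N}{k\ln(k/\delta)}+\log\log\frac k\delta\right)$ rounds, and * has total communication cost at most $C\left(k\log\log\frac{N}{k\ln(k/\delta)}+k\log\log\frac k\delta\right)$. -/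

import Mathlib

open MeasureTheory ProbabilityTheory

namespace DistTracking

/-- The kind of round that is being executed; `alarm` means that the coordinator has raised
the alarm and the algorithm has terminated. -/
inductive Phase where
  /-- every player sends a message for every item -/
  | straightforward
  /-- a round of the CMY algorithm (which, once entered, is run until it terminates) -/
  | cmy
  /-- a round with the static, distribution-dependent slacks -/
  | staticSlack
  | alarm
  deriving DecidableEq

/-- Global state of coordinator and players (plus the two quantities that are measured). -/
structure State (k : ℕ) where
  phase : Phase
  /-- the threshold `N` of the current round -/
  threshold : ℕ
  /-- the counters `n_i`, reset to `0` at the start of each round -/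
  counter : Fin k → ℕ
  /-- number of notifications received by the coordinator in the current round -/
  notifications : ℕ
  /-- number of rounds (of all three kinds) started so far -/
  rounds : ℕ
  /-- number of messages sent or received by the coordinator so far -/
  messages : ℕ

noncomputable section

/-- `√2 + 2/3`. -/
def slackConst : ℝ := Real.sqrt 2 + 2 / 3

/-- `β = 2 (√2 + 2/3)²`. -/
def beta : ℝ := 2 * slackConst ^ 2

/-- `t = N - (√2 + 2/3) √(k N ln(k/δ))`. -/
def target (k : ℕ) (δ : ℝ) (N : ℕ) : ℝ :=
  N - slackConst * Real.sqrt (k * N * Real.log (k / δ))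

/-- `s_i = μ_i t + √(2 t μ_i (1 - μ_i) ln(k/δ)) + (2/3) ln(k/δ)`. -/
def slack {k : ℕ} (μ : Fin k → ℝ) (δ : ℝ) (N : ℕ) (i : Fin k) : ℝ :=
  μ i * target k δ N
    + Real.sqrt (2 * target k δ N * μ i * (1 - μ i) * Real.log (k / δ))
    + 2 / 3 * Real.log (k / δ)

/-- The slack `⌊N / (2k)⌋` of the CMY algorithm. -/
def cmySlack (k N : ℕ) : ℕ := N / (2 * k)

/-- Which kind of round is run on threshold `N` when the preceding kind was `prev`.
At the very beginning, `prev` is `staticSlack`. -/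
def nextPhase (k : ℕ) (δ : ℝ) (prev : Phase) (N : ℕ) : Phase :=
  open Classical in
  if N = 0 then .alarm
  else if prev = .cmy then
    if N < 4 * k then .straightforward else .cmy
  else
    if N ≤ 4 * k then .straightforward
    else if (N : ℝ) ≤ beta * k * Real.log (k / δ) then .cmy
    else .staticSlack

/-- Whether player `i`, whose counter has just been increased to `n`, notifies the coordinator.
In a static-slack round this is when `n` reaches the (real) slack `s_i`. -/
def notifies {k : ℕ} (μ : Fin k → ℝ) (δ : ℝ) (N : ℕ) (i : Fin k) (n : ℕ) : Phase → Prop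
  | .straightforward => True
  | .cmy => cmySlack k N ∣ n
  | .staticSlack => slack μ δ N i ≤ n
  | .alarm => False

/-- The number `ℓ` of notifications that ends a round with threshold `N`. -/
def quota (k N : ℕ) : Phase → ℕ
  | .straightforward => N
  | .cmy => k
  | .staticSlack => 1
  | .alarm => 0

/-- Messages used for collecting the counters at the end of a round: one request to and one
reply from each player; nothing has to be collected by the straightforward algorithm. -/
def collectCost (k : ℕ) : Phase → ℕ
  | .straightforward => 0
  | .cmy => 2 * k
  | .staticSlack => 2 * k
  | .alarm => 0

/-- Start a round on threshold `N` by one message to each player (the slack, or the instruction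
to run the straightforward algorithm); if `N = 0`, raise the alarm instead. -/
def startRound (k : ℕ) (δ : ℝ) (prev : Phase) (N rounds messages : ℕ) : State k where
  phase := nextPhase k δ prev N
  threshold := N
  counter := fun _ => 0
  notifications := 0
  rounds := if N = 0 then rounds else rounds + 1
  messages := if N = 0 then messages else messages + k

/-- The transition caused by the arrival of one item at player `i`. -/
def step {k : ℕ} (μ : Fin k → ℝ) (δ : ℝ) (s : State k) (i : Fin k) : State k :=
  open Classical in
  if s.phase = .alarm then s
  else
    let c : Fin k → ℕ := Function.update s.counter i (s.counter i + 1)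
    if notifies μ δ s.threshold i (c i) s.phase then
      if s.notifications + 1 = quota k s.threshold s.phase then
        startRound k δ s.phase (s.threshold - ∑ j, c j) s.rounds
          (s.messages + 1 + collectCost k s.phase)
      else
        { s with
          counter := c
          notifications := s.notifications + 1
          messages := s.messages + 1 }
    else { s with counter := c }

/-- The state of StcSlk-KwnDst with threshold `N`, distribution `μ` and parameter `δ` after the
first `n` items `x 0, …, x (n - 1)` have arrived, where `x j` is the player receiving item `j`. -/
def run {k : ℕ} (μ : Fin k → ℝ) (δ : ℝ) (N : ℕ) (x : ℕ → Fin k) : ℕ → State k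
  | 0 => startRound k δ .staticSlack N 0 0
  | n + 1 => step μ δ (run μ δ N x n) (x n)

/-- `log log x` with each logarithm read as `max 1 (log ·)`, the usual convention under which
asymptotic bounds make sense for all values of the parameters. -/
def logLog (x : ℝ) : ℝ := max 1 (Real.log (max 1 (Real.log x)))

end

end DistTracking

/-!
The slacks of a static-slack round sum to at most `N`, and a CMY or straightforward round is
likewise over before its threshold is exceeded, so the alarm is never late; it is never early
because the collected counters determine the remaining threshold exactly.

Call a static-slack round good if its first `⌊t⌋` items leave every player below its slack. Such a
round replaces the threshold `N` by less than `N - t`, hence `y = N / ((√2 + 2/3)² k ln(k/δ))` by at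
most `√y`. Since `y > 2` in the static-slack regime, `O(log log y)` good rounds lead to
`N ≤ β k ln(k/δ)`. From there on each CMY round multiplies `N` by at most `3/4` until `N < 4k`,
which takes `O(log log(k/δ))` rounds. Every round costs `O(k)` messages.

By Bernstein's inequality and a union bound over the players, a static-slack round started after a
fixed number `a` of items is bad with probability at most `δ`. Whether a round starts after `a`
items depends on the items before `a` only and its goodness only on the items from `a` on, so the
two events are independent. As at most `R` of the first `R` rounds are static, summing over `a`
bounds the probability of a bad one among them by `δ R`, without conditioning on the history.
-/

namespace DistTracking

open Finset

lemma exp_le_of_nonneg_of_lt_three {x : ℝ} (h0 : 0 ≤ x) (h3 : x < 3) :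
    Real.exp x ≤ 1 + x + x ^ 2 / (2 * (1 - x / 3)) := by
  have hexp : HasSum (fun n : ℕ => x ^ n / (n.factorial : ℝ)) (Real.exp x) := by
    rw [Real.exp_eq_exp_ℝ]
    exact NormedSpace.expSeries_div_hasSum_exp x
  have htail := (hasSum_nat_add_iff' 2).mpr hexp
  have hgeom := (hasSum_geometric_of_lt_one (r := x / 3) (by positivity) (by linarith)).mul_left
    (x ^ 2 / 2)
  have hterm (n : ℕ) : x ^ (n + 2) / ((n + 2).factorial : ℝ) ≤ x ^ 2 / 2 * (x / 3) ^ n := by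
    have hfact : (2 * 3 ^ n : ℝ) ≤ ((n + 2).factorial : ℝ) := by
      rw [add_comm n 2]
      exact_mod_cast Nat.factorial_mul_pow_le_factorial (m := 2) (n := n)
    calc x ^ (n + 2) / ((n + 2).factorial : ℝ) ≤ x ^ (n + 2) / (2 * 3 ^ n) := by gcongr
      _ = x ^ 2 / 2 * (x / 3) ^ n := by rw [div_pow, pow_add]; field_simp
  have hle := hasSum_le hterm htail hgeom
  have hsum_two : ∑ n ∈ range 2, x ^ n / (n.factorial : ℝ) = 1 + x := by
    simp [sum_range_succ]
  rw [hsum_two] at hle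
  rw [← div_div, div_eq_mul_inv (x ^ 2 / 2)]
  linarith

lemma exp_le_of_nonpos {x : ℝ} (h0 : x ≤ 0) : Real.exp x ≤ 1 + x + x ^ 2 / 2 := by
  have hneg := Real.quadratic_le_exp_of_nonneg (x := -x) (by linarith)
  have hpos : 0 < 1 - x + x ^ 2 / 2 := by nlinarith
  have hmul : Real.exp x * (1 - x + x ^ 2 / 2) ≤ 1 := by
    calc Real.exp x * (1 - x + x ^ 2 / 2) ≤ Real.exp x * Real.exp (-x) := by
          gcongr; nlinarith
      _ = 1 := by rw [← Real.exp_add, add_neg_cancel, Real.exp_zero]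
  refine le_of_mul_le_mul_right (hmul.trans ?_) hpos
  nlinarith [sq_nonneg (x ^ 2)]

lemma exp_le_quadratic {h x : ℝ} (h0 : 0 ≤ h) (h3 : h < 3) (hx : x ≤ h) :
    Real.exp x ≤ 1 + x + x ^ 2 / (2 * (1 - h / 3)) := by
  rcases le_total x 0 with hx0 | hx0
  · refine (exp_le_of_nonpos hx0).trans ?_
    gcongr <;> linarith
  · refine (exp_le_of_nonneg_of_lt_three hx0 (hx.trans_lt h3)).trans ?_
    gcongr
    linarith

section Probability

variable {Ω : Type*} [MeasurableSpace Ω] {P : Measure Ω}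

lemma measurableSet_of_dependsOn {ι α : Type*} [MeasurableSpace α] [Countable α]
    [DiscreteMeasurableSpace α] {X : ι → Ω → α} (hX : ∀ j, Measurable (X j)) {S : Finset ι}
    {p : (ι → α) → Prop} (hp : DependsOn p (S : Set ι)) :
    MeasurableSet {ω | p fun j => X j ω} := by
  obtain ⟨q, rfl⟩ := dependsOn_iff_exists_comp.mp hp
  exact (measurable_pi_lambda (fun ω (j : S) => X j ω) fun j => hX j)
    (MeasurableSet.of_discrete (s := {y | q y}))

lemma measureReal_and_of_dependsOn {ι α : Type*} [MeasurableSpace α] [Countable α]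
    [DiscreteMeasurableSpace α] {X : ι → Ω → α} (hindep : iIndepFun X P)
    (hX : ∀ j, Measurable (X j)) {S T : Finset ι} (hST : Disjoint S T) {p q : (ι → α) → Prop}
    (hp : DependsOn p (S : Set ι)) (hq : DependsOn q (T : Set ι)) :
    P.real {ω | p (fun j => X j ω) ∧ q fun j => X j ω}
      = P.real {ω | p fun j => X j ω} * P.real {ω | q fun j => X j ω} := by
  obtain ⟨p', rfl⟩ := dependsOn_iff_exists_comp.mp hp
  obtain ⟨q', rfl⟩ := dependsOn_iff_exists_comp.mp hq
  have := (hindep.indepFun_finset S T hST hX).measure_inter_preimage_eq_mul {y | p' y} {y | q' y}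
    .of_discrete .of_discrete
  rw [measureReal_def, measureReal_def, measureReal_def, ← ENNReal.toReal_mul]
  exact congrArg ENNReal.toReal this

variable [IsProbabilityMeasure P]

lemma mgf_le_exp_variance_mul {Y : Ω → ℝ} {h : ℝ} (hY : MemLp Y 2 P) (hmean : P[Y] = 0)
    (hle : ∀ᵐ ω ∂P, Y ω ≤ 1) (h0 : 0 ≤ h) (h3 : h < 3) :
    mgf Y P h ≤ Real.exp (Var[Y; P] * (h ^ 2 / (2 * (1 - h / 3)))) := by
  set c := h ^ 2 / (2 * (1 - h / 3)) with hc
  have hint : Integrable Y P := hY.integrable one_le_two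
  have hint_sq : Integrable (fun ω => Y ω ^ 2) P := hY.integrable_sq
  have hlin : Integrable (fun ω => 1 + h * Y ω) P := (integrable_const 1).add (hint.const_mul h)
  calc mgf Y P h
      ≤ ∫ ω, (1 + h * Y ω) + Y ω ^ 2 * c ∂P := by
        refine integral_mono_ae (integrable_exp_mul_of_le h 1 h0 hint.aemeasurable hle)
          (hlin.add (hint_sq.mul_const c)) ?_
        filter_upwards [hle] with ω hω
        refine (exp_le_quadratic h0 h3 (mul_le_of_le_one_right h0 hω)).trans_eq ?_
        rw [hc]; ring
    _ = Var[Y; P] * c + 1 := by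
        rw [integral_add hlin (hint_sq.mul_const c), integral_mul_const,
          integral_add (integrable_const 1) (hint.const_mul h), integral_const_mul, hmean,
          variance_of_integral_eq_zero hint.aemeasurable hmean]
        simp [add_comm]
    _ ≤ Real.exp (Var[Y; P] * c) := Real.add_one_le_exp _

lemma exists_bernstein_exponent {V L : ℝ} (hV : 0 ≤ V) (hL : 0 < L) :
    ∃ h : ℝ, 0 ≤ h ∧ h < 3 ∧
      -h * (Real.sqrt (2 * V * L) + 2 / 3 * L) + V * (h ^ 2 / (2 * (1 - h / 3))) ≤ -L := by
  obtain ⟨a, ha, rfl⟩ : ∃ a, 0 ≤ a ∧ V = a ^ 2 :=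
    ⟨Real.sqrt V, Real.sqrt_nonneg V, (Real.sq_sqrt hV).symm⟩
  obtain ⟨b, hb, rfl⟩ : ∃ b, 0 < b ∧ L = b ^ 2 / 2 :=
    ⟨Real.sqrt (2 * L), Real.sqrt_pos.mpr (by positivity),
      by rw [Real.sq_sqrt (by positivity)]; ring⟩
  have hsqrt : Real.sqrt (2 * a ^ 2 * (b ^ 2 / 2)) = a * b := by
    rw [show 2 * a ^ 2 * (b ^ 2 / 2) = (a * b) ^ 2 by ring, Real.sqrt_sq (by positivity)]
  have hd : 0 < a + 2 * b / 3 := by positivity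
  -- `b / a` is optimal for the Gaussian part; the extra `2 * b / 3` keeps `h` below `3 / 2`.
  refine ⟨b / (a + 2 * b / 3), by positivity, ?_, ?_⟩
  · rw [div_lt_iff₀ hd]; linarith
  have hden : 1 - b / (a + 2 * b / 3) / 3 = (a + b / 3) / (a + 2 * b / 3) := by
    field_simp; ring
  have hvalue : -(b / (a + 2 * b / 3)) * (a * b + 2 / 3 * (b ^ 2 / 2))
      + a ^ 2 * ((b / (a + 2 * b / 3)) ^ 2 / (2 * ((a + b / 3) / (a + 2 * b / 3))))
      = b ^ 2 * (a ^ 2 - 2 * (a + b / 3) ^ 2) / (2 * ((a + b / 3) * (a + 2 * b / 3))) := by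
    field_simp; ring
  rw [hsqrt, hden, hvalue, div_le_iff₀ (by positivity)]
  have : 0 ≤ a * b ^ 3 := by positivity
  nlinarith

theorem bernstein_inequality {ι : Type*} {Y : ι → Ω → ℝ} (hindep : iIndepFun Y P)
    (hY : ∀ j, MemLp (Y j) 2 P) (hmean : ∀ j, P[Y j] = 0) (hle : ∀ j, ∀ᵐ ω ∂P, Y j ω ≤ 1)
    (s : Finset ι) {V L : ℝ} (hV : ∑ j ∈ s, Var[Y j; P] ≤ V) (hL : 0 < L) :
    P.real {ω | Real.sqrt (2 * V * L) + 2 / 3 * L ≤ ∑ j ∈ s, Y j ω} ≤ Real.exp (-L) := by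
  have hV0 : 0 ≤ V := (sum_nonneg fun j _ => variance_nonneg (Y j) P).trans hV
  obtain ⟨h, h0, h3, hexp⟩ := exists_bernstein_exponent hV0 hL
  set c := h ^ 2 / (2 * (1 - h / 3))
  have hc : 0 ≤ c := div_nonneg (sq_nonneg h) (by linarith)
  have hYm (j : ι) : AEMeasurable (Y j) P := (hY j).aestronglyMeasurable.aemeasurable
  have hsum_le : ∀ᵐ ω ∂P, (∑ j ∈ s, Y j) ω ≤ #s := by
    filter_upwards [(ae_ball_iff s.countable_toSet).mpr fun j _ => hle j] with ω hω
    simpa using sum_le_card_nsmul s (fun j => Y j ω) 1 hω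
  have hint := integrable_exp_mul_of_le h _ h0 (s.aemeasurable_sum fun j _ => hYm j) hsum_le
  have hmgf : mgf (∑ j ∈ s, Y j) P h ≤ Real.exp (V * c) := by
    calc mgf (∑ j ∈ s, Y j) P h = ∏ j ∈ s, mgf (Y j) P h := hindep.mgf_sum₀ hYm s
      _ ≤ ∏ j ∈ s, Real.exp (Var[Y j; P] * c) :=
          prod_le_prod (fun _ _ => mgf_nonneg) fun j _ =>
            mgf_le_exp_variance_mul (hY j) (hmean j) (hle j) h0 h3
      _ ≤ Real.exp (V * c) := by
          rw [← Real.exp_sum, ← sum_mul]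
          gcongr
  calc P.real {ω | Real.sqrt (2 * V * L) + 2 / 3 * L ≤ ∑ j ∈ s, Y j ω}
      ≤ Real.exp (-h * (Real.sqrt (2 * V * L) + 2 / 3 * L)) * mgf (∑ j ∈ s, Y j) P h := by
        simpa only [Finset.sum_apply] using
          measure_ge_le_exp_mul_mgf (Real.sqrt (2 * V * L) + 2 / 3 * L) h0 hint
    _ ≤ Real.exp (-h * (Real.sqrt (2 * V * L) + 2 / 3 * L)) * Real.exp (V * c) := by gcongr
    _ ≤ Real.exp (-L) := by rwa [← Real.exp_add, Real.exp_le_exp]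

lemma variance_indicator_one {A : Set Ω} (hA : MeasurableSet A) :
    Var[A.indicator 1; P] = P.real A * (1 - P.real A) := by
  classical
  have hor : ∀ᵐ ω ∂P, A.indicator (1 : Ω → ℝ) ω = 0 ∨ A.indicator (1 : Ω → ℝ) ω = 1 :=
    ae_of_all _ fun ω => by by_cases h : ω ∈ A <;> simp [h]
  have hzero : {ω | A.indicator (1 : Ω → ℝ) ω = 0} = Aᶜ := by ext ω; simp
  have hone : {ω | A.indicator (1 : Ω → ℝ) ω = 1} = A := by ext ω; simp [Set.indicator_apply]
  rw [variance_of_ae_eq_zero_or_one (measurable_one.indicator hA).aemeasurable hor, hzero, hone,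
    probReal_compl_eq_one_sub hA, mul_comm]

theorem measureReal_card_filter_ge_le_exp {ι α : Type*} [Nonempty ι] [MeasurableSpace α]
    [MeasurableSingletonClass α] [DecidableEq α] {X : ι → Ω → α}
    (hindep : iIndepFun X P) (hX : ∀ j, Measurable (X j)) {i : α} {p : ℝ}
    (hlaw : ∀ j, P.real {ω | X j ω = i} = p) (s : Finset ι) {t L : ℝ}
    (hs : #s ≤ t) (hL : 0 < L) :
    P.real {ω | p * t + Real.sqrt (2 * (t * p * (1 - p)) * L) + 2 / 3 * L
      ≤ #{j ∈ s | X j ω = i}} ≤ Real.exp (-L) := by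
  classical
  have hp0 : 0 ≤ p := hlaw (Classical.arbitrary ι) ▸ measureReal_nonneg
  have hp1 : p ≤ 1 := hlaw (Classical.arbitrary ι) ▸ measureReal_le_one
  have hms : MeasurableSet {i} := measurableSet_singleton i
  let A (j : ι) : Set Ω := X j ⁻¹' {i}
  have hA (j : ι) : MeasurableSet (A j) := hX j hms
  have hPA (j : ι) : P.real (A j) = p := hlaw j
  let Y (j : ι) (ω : Ω) : ℝ := (A j).indicator 1 ω - p
  have hind (j : ι) : MemLp ((A j).indicator (1 : Ω → ℝ)) 2 P :=
    memLp_indicator_const 2 (hA j) 1 (.inr (measure_ne_top P _))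
  have hY (j : ι) : MemLp (Y j) 2 P := (hind j).sub (memLp_const p)
  have hYindep : iIndepFun Y P :=
    hindep.comp (fun _ y => ({i} : Set α).indicator 1 y - p)
      fun _ => (measurable_one.indicator hms).sub_const p
  have hYmean (j : ι) : P[Y j] = 0 := by
    rw [integral_sub ((hind j).integrable one_le_two) (integrable_const p),
      integral_indicator_one (hA j), hPA]
    simp
  have hYle (j : ι) (ω : Ω) : Y j ω ≤ 1 := by
    have : (A j).indicator (1 : Ω → ℝ) ω ≤ 1 := Set.indicator_le_self' (by simp) ω
    linarith
  have hvar : ∑ j ∈ s, Var[Y j; P] ≤ t * p * (1 - p) := by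
    simp only [Y, variance_sub_const (hind _).aestronglyMeasurable, variance_indicator_one (hA _),
      hPA, sum_const, nsmul_eq_mul, ← mul_assoc]
    have : 0 ≤ 1 - p := by linarith
    gcongr
  refine (measureReal_mono fun ω hω => ?_).trans
    (bernstein_inequality hYindep hY hYmean (fun j => ae_of_all _ (hYle j)) s hvar hL)
  have hcount : ∑ j ∈ s, Y j ω = #{j ∈ s | X j ω = i} - #s * p := by
    simp [Y, A, Set.indicator_apply]
  have : #s * p ≤ t * p := by gcongr
  simp only [Set.mem_ofPred_eq] at hω ⊢
  linarith

lemma sum_measureReal_le_of_card_filter_le {ι : Type*} {A : ι → Set Ω} {s : Finset ι} {R : ℕ}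
    (hA : ∀ j ∈ s, MeasurableSet (A j))
    (hcard : ∀ ω, (open Classical in #{j ∈ s | ω ∈ A j}) ≤ R) :
    ∑ j ∈ s, P.real (A j) ≤ R := by
  classical
  have hint (j : ι) (hj : j ∈ s) : Integrable ((A j).indicator (1 : Ω → ℝ)) P :=
    (integrable_const 1).indicator (hA j hj)
  calc ∑ j ∈ s, P.real (A j) = ∫ ω, ∑ j ∈ s, (A j).indicator 1 ω ∂P := by
        rw [integral_finsetSum s hint]
        exact sum_congr rfl fun j hj => (integral_indicator_one (hA j hj)).symm
    _ ≤ ∫ _, (R : ℝ) ∂P := by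
        refine integral_mono (integrable_finsetSum s hint) (integrable_const _) fun ω => ?_
        simpa [Set.indicator_apply] using hcard ω
    _ = R := by simp

lemma measureReal_biUnion_inter_le {ι : Type*} {A B : ι → Set Ω} {s : Finset ι} {R : ℕ} {q : ℝ}
    (hq : 0 ≤ q) (hA : ∀ j ∈ s, MeasurableSet (A j))
    (hcard : ∀ ω, (open Classical in #{j ∈ s | ω ∈ A j}) ≤ R)
    (hAB : ∀ j ∈ s, P.real (A j ∩ B j) ≤ q * P.real (A j)) :
    P.real (⋃ j ∈ s, A j ∩ B j) ≤ q * R :=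
  calc P.real (⋃ j ∈ s, A j ∩ B j) ≤ ∑ j ∈ s, P.real (A j ∩ B j) :=
        measureReal_biUnion_finset_le _ _
    _ ≤ q * ∑ j ∈ s, P.real (A j) := by rw [mul_sum]; exact sum_le_sum hAB
    _ ≤ q * R := by gcongr; exact sum_measureReal_le_of_card_filter_le hA hcard

end Probability

section Slacks

variable {k N : ℕ} {μ : Fin k → ℝ} {δ : ℝ}

lemma slackConst_pos : 0 < slackConst := by
  unfold slackConst; positivity

lemma beta_pos : 0 < beta :=
  mul_pos two_pos (pow_pos slackConst_pos 2)

lemma four_lt_slackConst_sq : 4 < slackConst ^ 2 := by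
  have hsq : Real.sqrt 2 ^ 2 = 2 := Real.sq_sqrt (by norm_num)
  have hle : 1.4 ≤ Real.sqrt 2 := Real.le_sqrt_of_sq_le (by norm_num)
  unfold slackConst; nlinarith

lemma beta_le_ten : beta ≤ 10 := by
  have hsq : Real.sqrt 2 ^ 2 = 2 := Real.sq_sqrt (by norm_num)
  have hle : Real.sqrt 2 ≤ 1.5 := Real.sqrt_le_iff.mpr (by norm_num)
  unfold beta slackConst; nlinarith

lemma log_div_pos (hk : 0 < k) (h0 : 0 < δ) (h1 : δ < 1) : 0 < Real.log (k / δ) := by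
  have : (1 : ℝ) ≤ k := by exact_mod_cast hk
  exact Real.log_pos ((one_lt_div h0).mpr (h1.trans_le this))

lemma pos_of_log_div_pos (hL : 0 < Real.log (k / δ)) : 0 < k := by
  rcases Nat.eq_zero_or_pos k with rfl | hk
  · simp at hL
  · exact hk

lemma target_pos (hL : 0 < Real.log (k / δ)) (hN : beta * k * Real.log (k / δ) < N) :
    0 < target k δ N := by
  have hc := slackConst_pos
  have hβ := beta_pos
  unfold target
  set L := Real.log (k / δ)
  have hkL : 0 ≤ (k : ℝ) * L := by positivity
  have hN0 : (0 : ℝ) < N := lt_of_le_of_lt (by positivity) hN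
  have hsqrt : Real.sqrt (k * N * L) < N / slackConst := by
    rw [Real.sqrt_lt' (by positivity), div_pow, lt_div_iff₀ (by positivity)]
    unfold beta at hN
    nlinarith [mul_nonneg (sq_nonneg slackConst) hkL]
  rw [lt_div_iff₀' hc] at hsqrt
  exact sub_pos.mpr hsqrt

lemma target_le (k N : ℕ) (δ : ℝ) : target k δ N ≤ N :=
  sub_le_self _ (mul_nonneg slackConst_pos.le (Real.sqrt_nonneg _))

lemma sum_sqrt_le_sqrt_card_mul_sum {ι : Type*} {s : Finset ι} {f : ι → ℝ}
    (hf : ∀ i ∈ s, 0 ≤ f i) : ∑ i ∈ s, Real.sqrt (f i) ≤ Real.sqrt (#s * ∑ i ∈ s, f i) := by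
  refine Real.le_sqrt_of_sq_le ((sq_sum_le_card_mul_sum_sq).trans_eq ?_)
  rw [sum_congr rfl fun i hi => Real.sq_sqrt (hf i hi)]

lemma sum_sqrt_variance_le {ι : Type*} [Fintype ι] {μ : ι → ℝ} (hμ : μ ∈ stdSimplex ℝ ι) {c : ℝ}
    (hc : 0 ≤ c) :
    ∑ i, Real.sqrt (c * (μ i * (1 - μ i))) ≤ Real.sqrt (Fintype.card ι * c) := by
  have hμ1 (i : ι) : 0 ≤ 1 - μ i := sub_nonneg.mpr (mem_Icc_of_mem_stdSimplex hμ i).2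
  refine (sum_sqrt_le_sqrt_card_mul_sum fun i _ =>
    mul_nonneg hc (mul_nonneg (hμ.1 i) (hμ1 i))).trans (Real.sqrt_le_sqrt ?_)
  have hle (i : ι) : c * (μ i * (1 - μ i)) ≤ c * μ i := by
    nlinarith [mul_nonneg hc (hμ.1 i), hμ.1 i]
  calc (#(univ : Finset ι) : ℝ) * ∑ i, c * (μ i * (1 - μ i))
      ≤ Fintype.card ι * ∑ i, c * μ i :=
        mul_le_mul_of_nonneg_left (sum_le_sum fun i _ => hle i) (Nat.cast_nonneg _)
    _ = Fintype.card ι * c := by rw [← mul_sum, hμ.2, mul_one]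

lemma mul_log_le_sqrt (hL : 0 < Real.log (k / δ)) (hN : beta * k * Real.log (k / δ) < N) :
    k * Real.log (k / δ) ≤ Real.sqrt (k * N * Real.log (k / δ)) := by
  set L := Real.log (k / δ)
  have hkL : 0 ≤ (k : ℝ) * L := by positivity
  have hβ : 1 ≤ beta := by unfold beta; linarith [four_lt_slackConst_sq]
  have : k * L ≤ N := by nlinarith
  exact Real.le_sqrt_of_sq_le (by nlinarith)

lemma sum_slack_le (hL : 0 < Real.log (k / δ)) (hμ : μ ∈ stdSimplex ℝ (Fin k))
    (hN : beta * k * Real.log (k / δ) < N) : ∑ i, slack μ δ N i ≤ N := by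
  have ht := target_pos hL hN
  have hlin := mul_log_le_sqrt hL hN
  have hdev : ∑ i, Real.sqrt (2 * target k δ N * μ i * (1 - μ i) * Real.log (k / δ))
      ≤ Real.sqrt 2 * Real.sqrt (k * N * Real.log (k / δ)) := by
    calc ∑ i, Real.sqrt (2 * target k δ N * μ i * (1 - μ i) * Real.log (k / δ))
        = ∑ i, Real.sqrt (2 * target k δ N * Real.log (k / δ) * (μ i * (1 - μ i))) := by
          congr! 2; ring
      _ ≤ Real.sqrt (k * (2 * target k δ N * Real.log (k / δ))) := by
          simpa using sum_sqrt_variance_le hμ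
            (by positivity : 0 ≤ 2 * target k δ N * Real.log (k / δ))
      _ ≤ Real.sqrt (2 * (k * N * Real.log (k / δ))) := by
          have := target_le k N δ
          apply Real.sqrt_le_sqrt
          calc k * (2 * target k δ N * Real.log (k / δ))
              ≤ k * (2 * N * Real.log (k / δ)) := by gcongr
            _ = 2 * (k * N * Real.log (k / δ)) := by ring
      _ = _ := Real.sqrt_mul zero_le_two _
  calc ∑ i, slack μ δ N i
      = target k δ N + ∑ i, Real.sqrt (2 * target k δ N * μ i * (1 - μ i) * Real.log (k / δ))
        + 2 / 3 * (k * Real.log (k / δ)) := by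
        simp only [slack, sum_add_distrib, ← sum_mul, hμ.2, one_mul, sum_const, card_univ,
          Fintype.card_fin, nsmul_eq_mul]
        ring
    _ ≤ target k δ N + slackConst * Real.sqrt (k * N * Real.log (k / δ)) := by
        rw [slackConst, add_mul]; linarith
    _ = N := sub_add_cancel _ _

lemma slack_pos (hL : 0 < Real.log (k / δ)) (hμ : ∀ i, 0 ≤ μ i)
    (hN : beta * k * Real.log (k / δ) < N) (i : Fin k) : 0 < slack μ δ N i := by
  have ht := target_pos hL hN
  have := hμ i
  unfold slack
  positivity

lemma cmySlack_pos (hk : 0 < k) (hN : 4 * k ≤ N) : 0 < cmySlack k N :=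
  Nat.div_pos (by omega) (by omega)

lemma sum_lt_of_sum_div_cmySlack_le (hk : 0 < k) (hN : 4 * k ≤ N) {c : Fin k → ℕ}
    (hc : ∑ i, c i / cmySlack k N ≤ k) : ∑ i, c i < N := by
  have hs := cmySlack_pos hk hN
  have : Nonempty (Fin k) := ⟨⟨0, hk⟩⟩
  calc ∑ i, c i < ∑ i, cmySlack k N * (c i / cmySlack k N + 1) :=
        sum_lt_sum_of_nonempty univ_nonempty fun i _ => Nat.lt_mul_div_succ (c i) hs
    _ = cmySlack k N * (∑ i, c i / cmySlack k N + k) := by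
        simp [← mul_sum, sum_add_distrib]
    _ ≤ cmySlack k N * (k + k) := by gcongr
    _ = 2 * k * cmySlack k N := by ring
    _ ≤ N := Nat.mul_div_le _ _

end Slacks

section Counters

variable {ι : Type*} [DecidableEq ι]

/-- The counters after one more item has arrived at player `i`. -/
def bump (c : ι → ℕ) (i : ι) : ι → ℕ := Function.update c i (c i + 1)

lemma bump_apply (c : ι → ℕ) (i j : ι) : bump c i j = c j + if i = j then 1 else 0 := by
  rcases eq_or_ne i j with rfl | hij
  · simp [bump]
  · simp [bump, Function.update_of_ne hij.symm, hij]

lemma sum_bump [Fintype ι] (c : ι → ℕ) (i : ι) : ∑ j, bump c i j = ∑ j, c j + 1 := by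
  simp [bump_apply, sum_add_distrib]

lemma sum_bump_div [Fintype ι] (c : ι → ℕ) (i : ι) (s : ℕ) :
    ∑ j, bump c i j / s = ∑ j, c j / s + if s ∣ c i + 1 then 1 else 0 := by
  have hdiv (j : ι) :
      bump c i j / s = c j / s + if i = j then (if s ∣ c i + 1 then 1 else 0) else 0 := by
    rcases eq_or_ne i j with rfl | hij
    · simp [bump_apply, Nat.succ_div]
    · simp [bump_apply, hij]
  simp [hdiv, sum_add_distrib]

/-- The number of items with indices in `[a, n)` that each player receives from the stream `x`. -/
def itemCount (x : ℕ → ι) (a n : ℕ) (i : ι) : ℕ := #{j ∈ Ico a n | x j = i}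

lemma itemCount_self (x : ℕ → ι) (a : ℕ) : itemCount x a a = 0 := by
  ext i; simp [itemCount]

lemma itemCount_succ (x : ℕ → ι) {a n : ℕ} (han : a ≤ n) :
    itemCount x a (n + 1) = bump (itemCount x a n) (x n) := by
  ext i
  simp only [itemCount, bump_apply, card_filter, sum_Ico_succ_top han]

lemma sum_itemCount [Fintype ι] (x : ℕ → ι) (a n : ℕ) : ∑ i, itemCount x a n i = n - a := by
  rw [← Nat.card_Ico, card_eq_sum_card_fiberwise (f := x) (t := univ) (by simp [Set.MapsTo])]
  rfl

lemma itemCount_mono_right (x : ℕ → ι) (a : ℕ) {m n : ℕ} (hmn : m ≤ n) (i : ι) :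
    itemCount x a m i ≤ itemCount x a n i :=
  card_le_card (filter_subset_filter _ (Ico_subset_Ico_right hmn))

lemma dependsOn_itemCount (a n : ℕ) :
    DependsOn (fun x : ℕ → ι => itemCount x a n) (Ico a n : Set ℕ) := by
  intro x y hxy
  ext i
  exact congrArg card (filter_congr fun j hj => by rw [hxy j (mem_coe.mpr hj)])

end Counters

section Transition

variable {k : ℕ} {μ : Fin k → ℝ} {δ : ℝ} {s : State k} {i : Fin k}

/-- The next item completes the current round if it arrives at player `i`. -/
def Completes (μ : Fin k → ℝ) (δ : ℝ) (s : State k) (i : Fin k) : Prop :=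
  notifies μ δ s.threshold i (s.counter i + 1) s.phase ∧
    s.notifications + 1 = quota k s.threshold s.phase

open Classical in
/-- The state after an item at player `i` that does not complete the current round. -/
noncomputable def advance (μ : Fin k → ℝ) (δ : ℝ) (s : State k) (i : Fin k) : State k :=
  let d := if notifies μ δ s.threshold i (s.counter i + 1) s.phase then 1 else 0
  { s with
    counter := bump s.counter i
    notifications := s.notifications + d
    messages := s.messages + d }

/-- The state after an item that completes the current round; it does not matter which player
has received that item. -/
noncomputable def finish (δ : ℝ) (s : State k) : State k :=
  startRound k δ s.phase (s.threshold - (∑ j, s.counter j + 1)) s.rounds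
    (s.messages + 1 + collectCost k s.phase)

lemma step_of_phase_eq_alarm (hs : s.phase = .alarm) : step μ δ s i = s := by
  simp [step, hs]

lemma step_of_completes (h : Completes μ δ s i) : step μ δ s i = finish δ s := by
  have hs : s.phase ≠ .alarm := fun hs => by simp [Completes, notifies, hs] at h
  have hsum := sum_bump s.counter i
  unfold bump at hsum
  simp only [step, hs, if_false, Function.update_self, h.1, h.2, if_true, finish, hsum]

lemma step_of_not_completes (hs : s.phase ≠ .alarm) (h : ¬ Completes μ δ s i) :
    step μ δ s i = advance μ δ s i := by
  by_cases hn : notifies μ δ s.threshold i (s.counter i + 1) s.phase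
  · have hq : s.notifications + 1 ≠ quota k s.threshold s.phase := fun hq => h ⟨hn, hq⟩
    simp [step, hs, hn, hq, advance, bump]
  · simp [step, hs, hn, advance, bump]

lemma nextPhase_eq_alarm_iff {prev : Phase} {N : ℕ} : nextPhase k δ prev N = .alarm ↔ N = 0 := by
  unfold nextPhase
  split_ifs <;> simp_all

end Transition

section Invariant

variable {k N n a : ℕ} {μ : Fin k → ℝ} {δ : ℝ} {s : State k} {i : Fin k} {x : ℕ → Fin k}

/-- The invariant of a running round: the notifications received are those prescribed for the
current counters, and their number is below the quota. In particular no round is running once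
the alarm has been raised. -/
def RoundInv (μ : Fin k → ℝ) (δ : ℝ) (s : State k) : Prop :=
  match s.phase with
  | .straightforward =>
      s.threshold ≤ 4 * k ∧ s.notifications = ∑ i, s.counter i ∧ ∑ i, s.counter i < s.threshold
  | .cmy =>
      4 * k ≤ s.threshold ∧ s.notifications = ∑ i, s.counter i / cmySlack k s.threshold ∧
        s.notifications < k
  | .staticSlack =>
      beta * k * Real.log (k / δ) < s.threshold ∧ s.notifications = 0 ∧
        ∀ i, s.counter i < slack μ δ s.threshold i
  | .alarm => False

lemma RoundInv.phase_ne_alarm (h : RoundInv μ δ s) : s.phase ≠ .alarm :=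
  fun hs => by simp [RoundInv, hs] at h

lemma RoundInv.sum_lt (hL : 0 < Real.log (k / δ)) (hμ : μ ∈ stdSimplex ℝ (Fin k))
    (h : RoundInv μ δ s) : ∑ i, s.counter i < s.threshold := by
  have hk := pos_of_log_div_pos hL
  cases hp : s.phase <;> simp only [RoundInv, hp] at h
  · exact h.2.2
  · exact sum_lt_of_sum_div_cmySlack_le hk h.1 (h.2.1 ▸ h.2.2.le)
  · have : Nonempty (Fin k) := ⟨⟨0, hk⟩⟩
    have hlt : ∑ i, (s.counter i : ℝ) < ∑ i, slack μ δ s.threshold i :=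
      sum_lt_sum_of_nonempty univ_nonempty fun i _ => h.2.2 i
    exact_mod_cast hlt.trans_le (sum_slack_le hL hμ h.1)

lemma roundInv_startRound (hL : 0 < Real.log (k / δ)) (hμ : ∀ i, 0 ≤ μ i) (hN : 0 < N)
    (prev : Phase) (r m : ℕ) : RoundInv μ δ (startRound k δ prev N r m) := by
  have hk := pos_of_log_div_pos hL
  simp only [RoundInv, startRound, nextPhase, hN.ne', if_false]
  split_ifs with h1 h2 h3 h4
  · exact ⟨by omega, by simp, by simpa using hN⟩
  · exact ⟨by omega, by simp, hk⟩
  · exact ⟨h3, by simp, by simpa using hN⟩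
  · exact ⟨by omega, by simp, hk⟩
  · simpa [not_le.mp h4] using slack_pos hL hμ (not_le.mp h4)

lemma RoundInv.advance (h : RoundInv μ δ s) (hc : ¬ Completes μ δ s i) :
    RoundInv μ δ (advance μ δ s i) := by
  cases hp : s.phase <;> simp only [RoundInv, hp] at h
  · simp only [Completes, hp, notifies, quota, true_and] at hc
    simp only [RoundInv, DistTracking.advance, hp, notifies, if_true, sum_bump]
    omega
  · simp only [Completes, hp, notifies, quota] at hc
    simp only [RoundInv, DistTracking.advance, hp, notifies, sum_bump_div]
    split_ifs at * <;> omega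
  · have hn : ¬ slack μ δ s.threshold i ≤ (s.counter i + 1 : ℕ) := fun hn =>
      hc ⟨by simpa only [hp, notifies] using hn, by simp [hp, quota, h.2.1]⟩
    simp only [RoundInv, DistTracking.advance, hp, notifies, hn, if_false, add_zero]
    refine ⟨h.1, h.2.1, fun j => ?_⟩
    rcases eq_or_ne i j with rfl | hij
    · simpa [bump_apply] using hn
    · simpa [bump_apply, hij] using h.2.2 j

lemma RoundInv.cmySlack_mul_le (h : RoundInv μ δ s) (hs : s.phase = .cmy)
    (hc : Completes μ δ s i) : cmySlack k s.threshold * k ≤ ∑ j, s.counter j + 1 := by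
  simp only [RoundInv, hs] at h
  simp only [Completes, hs, notifies, quota] at hc
  calc cmySlack k s.threshold * k
      = cmySlack k s.threshold * ∑ j, bump s.counter i j / cmySlack k s.threshold := by
        rw [sum_bump_div, if_pos hc.1, ← h.2.1, hc.2]
    _ ≤ ∑ j, bump s.counter i j := by
        rw [mul_sum]
        exact sum_le_sum fun j _ => Nat.mul_div_le _ _
    _ = ∑ j, s.counter j + 1 := sum_bump _ _

/-- After `n` items a round is running that was started after `a` items. Every round has a budget
of `5k` messages: `k` for the instructions and `4k` for its notifications and the collection. -/
structure InRound (μ : Fin k → ℝ) (δ : ℝ) (N : ℕ) (x : ℕ → Fin k) (a n : ℕ) : Prop where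
  start_le : a ≤ n
  start_add_threshold : a + (run μ δ N x n).threshold = N
  counter_eq : (run μ δ N x n).counter = itemCount x a n
  phase_start : (run μ δ N x a).phase = (run μ δ N x n).phase
  rounds_start : (run μ δ N x a).rounds = (run μ δ N x n).rounds
  counter_start : (run μ δ N x a).counter = 0
  roundInv : RoundInv μ δ (run μ δ N x n)
  messages_le : (run μ δ N x n).messages + 4 * k
    ≤ 5 * k * (run μ δ N x n).rounds + (run μ δ N x n).notifications

lemma InRound.sum_counter (h : InRound μ δ N x a n) : ∑ i, (run μ δ N x n).counter i = n - a := by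
  rw [h.counter_eq, sum_itemCount]

lemma InRound.lt (hL : 0 < Real.log (k / δ)) (hμ : μ ∈ stdSimplex ℝ (Fin k))
    (h : InRound μ δ N x a n) : n < N := by
  have hlt := h.roundInv.sum_lt hL hμ
  rw [h.sum_counter] at hlt
  have := h.start_add_threshold
  omega

lemma inRound_of_startRound (hL : 0 < Real.log (k / δ)) (hμ : ∀ i, 0 ≤ μ i) {prev : Phase}
    {T r m : ℕ} (hrun : run μ δ N x n = startRound k δ prev T r m) (hT : 0 < T) (hn : n + T = N)
    (hm : m ≤ 5 * k * r) : InRound μ δ N x n n where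
  start_le := le_rfl
  start_add_threshold := by rw [hrun]; exact hn
  counter_eq := by rw [hrun, itemCount_self]; rfl
  phase_start := rfl
  rounds_start := rfl
  counter_start := by rw [hrun]; rfl
  roundInv := hrun ▸ roundInv_startRound hL hμ hT prev r m
  messages_le := by
    simp only [hrun, startRound, hT.ne', if_false]
    linarith

lemma InRound.succ (h : InRound μ δ N x a n) (hc : ¬ Completes μ δ (run μ δ N x n) (x n)) :
    InRound μ δ N x a (n + 1) := by
  have hrun : run μ δ N x (n + 1) = advance μ δ (run μ δ N x n) (x n) :=
    step_of_not_completes h.roundInv.phase_ne_alarm hc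
  exact {
    start_le := Nat.le_succ_of_le h.start_le
    start_add_threshold := hrun ▸ h.start_add_threshold
    counter_eq := by
      rw [hrun, itemCount_succ x h.start_le, ← h.counter_eq]
      rfl
    phase_start := hrun ▸ h.phase_start
    rounds_start := hrun ▸ h.rounds_start
    counter_start := h.counter_start
    roundInv := hrun ▸ h.roundInv.advance hc
    messages_le := by
      have := h.messages_le
      rw [hrun]
      simp only [advance]
      omega }

lemma InRound.messages_finish_le (h : InRound μ δ N x a n)
    (hc : Completes μ δ (run μ δ N x n) i) :
    (run μ δ N x n).messages + 1 + collectCost k (run μ δ N x n).phase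
      ≤ 5 * k * (run μ δ N x n).rounds := by
  have hm := h.messages_le
  have hr := h.roundInv
  have hq := hc.2
  have hk : 0 < k := Fin.pos i
  cases hp : (run μ δ N x n).phase <;> simp only [RoundInv, hp] at hr <;>
    simp only [hp, quota, collectCost] at hq ⊢ <;> omega

theorem alarm_or_inRound (hL : 0 < Real.log (k / δ)) (hμ : μ ∈ stdSimplex ℝ (Fin k)) (hN : 0 < N)
    (x : ℕ → Fin k) (n : ℕ) :
    ((run μ δ N x n).phase = .alarm ∧ N ≤ n ∧
      (run μ δ N x n).messages ≤ 5 * k * (run μ δ N x n).rounds) ∨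
    ∃ a, InRound μ δ N x a n := by
  induction n with
  | zero => exact .inr ⟨0, inRound_of_startRound hL hμ.1 rfl hN (zero_add N) (Nat.zero_le _)⟩
  | succ n ih =>
    rcases ih with ⟨hs, hn, hm⟩ | ⟨a, h⟩
    · have hrun : run μ δ N x (n + 1) = run μ δ N x n := step_of_phase_eq_alarm hs
      exact .inl (hrun ▸ ⟨hs, Nat.le_succ_of_le hn, hm⟩)
    by_cases hc : Completes μ δ (run μ δ N x n) (x n)
    · have hrun : run μ δ N x (n + 1) = finish δ (run μ δ N x n) := step_of_completes hc
      have hm := h.messages_finish_le hc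
      have hT := h.start_add_threshold
      have han := h.start_le
      have := h.lt hL hμ
      simp only [finish, h.sum_counter] at hrun
      rcases Nat.eq_zero_or_pos ((run μ δ N x n).threshold - (n - a + 1)) with h0 | hpos
      · rw [h0] at hrun
        simp only [hrun, startRound, nextPhase_eq_alarm_iff, if_true]
        exact .inl ⟨trivial, by omega, hm⟩
      · exact .inr ⟨n + 1, inRound_of_startRound hL hμ.1 hrun hpos (by omega) hm⟩
    · exact .inr ⟨a, h.succ hc⟩

theorem run_phase_eq_alarm_iff (hL : 0 < Real.log (k / δ)) (hμ : μ ∈ stdSimplex ℝ (Fin k))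
    (hN : 0 < N) (x : ℕ → Fin k) (n : ℕ) : (run μ δ N x n).phase = .alarm ↔ N ≤ n := by
  rcases alarm_or_inRound hL hμ hN x n with ⟨hs, hn, _⟩ | ⟨a, h⟩
  · exact ⟨fun _ => hn, fun _ => hs⟩
  · exact ⟨fun hs => absurd hs h.roundInv.phase_ne_alarm, fun hn => absurd hn (h.lt hL hμ).not_ge⟩

theorem messages_le_mul_rounds (hL : 0 < Real.log (k / δ)) (hμ : μ ∈ stdSimplex ℝ (Fin k))
    (hN : 0 < N) (x : ℕ → Fin k) :
    (run μ δ N x N).messages ≤ 5 * k * (run μ δ N x N).rounds := by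
  rcases alarm_or_inRound hL hμ hN x N with ⟨_, _, hm⟩ | ⟨a, h⟩
  · exact hm
  · exact absurd (h.lt hL hμ) (lt_irrefl N)

end Invariant

section Potential

variable {k N T m : ℕ} {μ : Fin k → ℝ} {δ : ℝ} {s : State k}

/-- The threshold in units of `(√2 + 2/3)² k ln(k/δ)`; the static-slack regime is `2 < y`. -/
noncomputable def normalizedThreshold (k : ℕ) (δ : ℝ) (N : ℕ) : ℝ :=
  N / (slackConst ^ 2 * (k * Real.log (k / δ)))

/-- A bound for the number of rounds that remain after a static-slack round that leads to another
kind of round. -/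
noncomputable def tailRounds (k : ℕ) (δ : ℝ) : ℝ :=
  1 + max 0 (Real.logb (4 / 3) (beta * Real.log (k / δ) / 4))

/-- A bound for the number of rounds still to be started after a round of the given kind on
threshold `N`, provided that the static-slack rounds are good. -/
noncomputable def potential (k : ℕ) (δ : ℝ) : Phase → ℕ → ℝ
  | .straightforward, _ => 0
  | .cmy, N => 1 + Real.logb (4 / 3) (N / (4 * k))
  | .staticSlack, N => tailRounds k δ + 1 + Real.logb 2 (Real.logb 2 (normalizedThreshold k δ N))
  | .alarm, _ => 0

lemma logb_add_one_le {b x y : ℝ} (hb : 1 < b) (hx : 0 < x) (h : x * b ≤ y) :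
    Real.logb b x + 1 ≤ Real.logb b y := by
  have hb0 : 0 < b := one_pos.trans hb
  rw [← Real.logb_self_eq_one hb, ← Real.logb_mul hx.ne' hb0.ne']
  exact Real.logb_le_logb_of_le hb (mul_pos hx hb0) h

lemma logb_logb_add_one_le {x y : ℝ} (hx : 1 < x) (h : x ^ 2 ≤ y) :
    Real.logb 2 (Real.logb 2 x) + 1 ≤ Real.logb 2 (Real.logb 2 y) := by
  refine logb_add_one_le one_lt_two (Real.logb_pos one_lt_two hx) ?_
  calc Real.logb 2 x * 2 = Real.logb 2 (x ^ 2) := by rw [Real.logb_pow]; push_cast; ring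
    _ ≤ Real.logb 2 y := Real.logb_le_logb_of_le one_lt_two (by positivity) h

lemma one_le_tailRounds (k : ℕ) (δ : ℝ) : 1 ≤ tailRounds k δ :=
  le_add_of_nonneg_right (le_max_left _ _)

lemma two_lt_normalizedThreshold (hL : 0 < Real.log (k / δ))
    (hN : beta * k * Real.log (k / δ) < N) : 2 < normalizedThreshold k δ N := by
  have hk := pos_of_log_div_pos hL
  have hc := slackConst_pos
  rw [normalizedThreshold, lt_div_iff₀ (by positivity)]
  unfold beta at hN
  linarith

lemma normalizedThreshold_sq_le (hL : 0 < Real.log (k / δ)) (h : m < T - target k δ T) :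
    normalizedThreshold k δ m ^ 2 ≤ normalizedThreshold k δ T := by
  have hk := pos_of_log_div_pos hL
  have hc := slackConst_pos
  unfold target at h
  unfold normalizedThreshold
  set L := Real.log (k / δ)
  have hsq : (m : ℝ) ^ 2 ≤ slackConst ^ 2 * (k * T * L) := by
    calc (m : ℝ) ^ 2 ≤ (slackConst * Real.sqrt (k * T * L)) ^ 2 := by
          gcongr; linarith
      _ = _ := by rw [mul_pow, Real.sq_sqrt (by positivity)]
  rw [div_pow, div_le_div_iff₀ (by positivity) (by positivity)]
  calc (m : ℝ) ^ 2 * (slackConst ^ 2 * (k * L))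
      ≤ slackConst ^ 2 * (k * T * L) * (slackConst ^ 2 * (k * L)) := by gcongr
    _ = T * (slackConst ^ 2 * (k * L)) ^ 2 := by ring

lemma one_le_potential_cmy (δ : ℝ) (hk : 0 < k) (hN : 4 * k ≤ N) :
    1 ≤ potential k δ .cmy N := by
  refine le_add_of_nonneg_right (Real.logb_nonneg (by norm_num) ?_)
  rw [one_le_div (by positivity)]
  exact_mod_cast hN

lemma tailRounds_add_one_le_potential (hL : 0 < Real.log (k / δ))
    (hN : beta * k * Real.log (k / δ) < N) :
    tailRounds k δ + 1 ≤ potential k δ .staticSlack N := by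
  have hy := two_lt_normalizedThreshold hL hN
  refine le_add_of_nonneg_right (Real.logb_nonneg one_lt_two ?_)
  rw [Real.le_logb_iff_rpow_le one_lt_two (by linarith), Real.rpow_one]
  exact hy.le

lemma RoundInv.potential_nonneg (hL : 0 < Real.log (k / δ)) (h : RoundInv μ δ s) :
    0 ≤ potential k δ s.phase s.threshold := by
  cases hp : s.phase <;> simp only [RoundInv, hp] at h
  · exact le_rfl
  · exact zero_le_one.trans (one_le_potential_cmy δ (pos_of_log_div_pos hL) h.1)
  · linarith [tailRounds_add_one_le_potential hL h.1, one_le_tailRounds k δ]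

lemma potential_cmy_le_tailRounds (hN : 0 < N) (hN' : N ≤ beta * k * Real.log (k / δ)) :
    potential k δ .cmy N ≤ tailRounds k δ := by
  have hN0 : (0 : ℝ) < N := Nat.cast_pos.mpr hN
  have hk : (0 : ℝ) < k := by
    refine (Nat.cast_nonneg k).lt_of_ne fun hk => ?_
    rw [← hk] at hN'
    linarith
  refine add_le_add_right (le_max_of_le_right ?_) 1
  refine Real.logb_le_logb_of_le (by norm_num) (by positivity) ?_
  rw [div_le_div_iff₀ (by positivity) (by positivity)]
  linarith

lemma nextPhase_staticSlack_cases (hN : 0 < N) :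
    potential k δ (nextPhase k δ .staticSlack N) N ≤ tailRounds k δ ∨
    (nextPhase k δ .staticSlack N = .staticSlack ∧ beta * k * Real.log (k / δ) < N) := by
  simp only [nextPhase, hN.ne', reduceCtorEq, if_false]
  split_ifs with h1 h2
  · exact .inl (zero_le_one.trans (one_le_tailRounds k δ))
  · exact .inl (potential_cmy_le_tailRounds hN h2)
  · exact .inr ⟨rfl, not_le.mp h2⟩

lemma potential_nextPhase_cmy_add_one_le (hk : 0 < k) (hT : 4 * k ≤ T) (hm : 0 < m)
    (h : 4 * m ≤ 3 * T) :
    potential k δ (nextPhase k δ .cmy m) m + 1 ≤ potential k δ .cmy T := by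
  simp only [nextPhase, hm.ne', if_true, if_false]
  split_ifs
  · exact (zero_add 1).trans_le (one_le_potential_cmy δ hk hT)
  · have h' : (4 : ℝ) * m ≤ 3 * T := by exact_mod_cast h
    have hle : (m : ℝ) / (4 * k) * (4 / 3) ≤ T / (4 * k) := by
      rw [div_mul_eq_mul_div]
      gcongr
      linarith
    simp only [potential, add_assoc]
    exact add_le_add_right (logb_add_one_le (by norm_num) (by positivity) hle) 1

lemma potential_nextPhase_staticSlack_add_one_le (hL : 0 < Real.log (k / δ))
    (hT : beta * k * Real.log (k / δ) < T) (hm : 0 < m) (h : m < T - target k δ T) :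
    potential k δ (nextPhase k δ .staticSlack m) m + 1 ≤ potential k δ .staticSlack T := by
  rcases nextPhase_staticSlack_cases (k := k) (δ := δ) hm with htail | ⟨hnext, hm'⟩
  · linarith [tailRounds_add_one_le_potential hL hT]
  · rw [hnext]
    have hy := two_lt_normalizedThreshold hL hm'
    have := logb_logb_add_one_le (by linarith) (normalizedThreshold_sq_le hL h)
    simp only [potential]
    linarith

lemma RoundInv.four_mul_sub_le (h : RoundInv μ δ s) (hs : s.phase = .cmy) {i : Fin k}
    (hc : Completes μ δ s i) : 4 * (s.threshold - (∑ j, s.counter j + 1)) ≤ 3 * s.threshold := by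
  have hle := h.cmySlack_mul_le hs hc
  simp only [RoundInv, hs] at h
  have hk : 0 < k := Fin.pos i
  have hk_le : k ≤ cmySlack k s.threshold * k := Nat.le_mul_of_pos_left _ (cmySlack_pos hk h.1)
  have hlt : s.threshold < 2 * (cmySlack k s.threshold * k) + 2 * k :=
    calc s.threshold < 2 * k * (cmySlack k s.threshold + 1) := Nat.lt_mul_div_succ _ (by omega)
      _ = 2 * (cmySlack k s.threshold * k) + 2 * k := by ring
  omega

end Potential

section Rounds

variable {k N n a R : ℕ} {μ : Fin k → ℝ} {δ : ℝ} {x : ℕ → Fin k}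

/-- A static-slack round that is started after `a` items is good: within its first `⌊t⌋` items no
player reaches its slack. -/
def GoodFrom (μ : Fin k → ℝ) (δ : ℝ) (N : ℕ) (x : ℕ → Fin k) (a : ℕ) : Prop :=
  ∀ i, itemCount x a (a + ⌊target k δ (N - a)⌋₊) i < slack μ δ (N - a) i

/-- After `a` items a static-slack round has just been started, which is one of the first `R`
rounds. -/
def EarlyStaticStart (μ : Fin k → ℝ) (δ : ℝ) (N R : ℕ) (x : ℕ → Fin k) (a : ℕ) : Prop :=
  (run μ δ N x a).phase = .staticSlack ∧ (run μ δ N x a).counter = 0 ∧ (run μ δ N x a).rounds ≤ R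

/-- All static-slack rounds among the first `R` rounds are good. -/
def EarlyRoundsGood (μ : Fin k → ℝ) (δ : ℝ) (N R : ℕ) (x : ℕ → Fin k) : Prop :=
  ∀ a < N, EarlyStaticStart μ δ N R x a → GoodFrom μ δ N x a

lemma InRound.target_lt (h : InRound μ δ N x a n) (hs : (run μ δ N x n).phase = .staticSlack)
    (hc : Completes μ δ (run μ δ N x n) (x n)) (hg : GoodFrom μ δ N x a) :
    target k δ (run μ δ N x n).threshold < (n - a + 1 : ℕ) := by
  have hT : N - a = (run μ δ N x n).threshold := by have := h.start_add_threshold; omega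
  have han := h.start_le
  by_contra! hle
  have hreach := hc.1
  have hgood := hg (x n)
  simp only [notifies, hs] at hreach
  rw [hT] at hgood
  have hfloor : n + 1 ≤ a + ⌊target k δ (run μ δ N x n).threshold⌋₊ := by
    have := Nat.le_floor hle
    omega
  have hcount : (run μ δ N x n).counter (x n) + 1
      ≤ itemCount x a (a + ⌊target k δ (run μ δ N x n).threshold⌋₊) (x n) := by
    refine le_trans ?_ (itemCount_mono_right x a hfloor (x n))
    simp [itemCount_succ x han, bump_apply, h.counter_eq]
  exact (hgood.trans_le hreach).not_ge (Nat.cast_le.mpr hcount)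

lemma InRound.potential_nextPhase_add_one_le (hL : 0 < Real.log (k / δ))
    (h : InRound μ δ N x a n) (hc : Completes μ δ (run μ δ N x n) (x n))
    (hg : (run μ δ N x n).phase = .staticSlack → GoodFrom μ δ N x a) {m : ℕ} (hm : 0 < m)
    (hmT : m = (run μ δ N x n).threshold - (n - a + 1)) :
    potential k δ (nextPhase k δ (run μ δ N x n).phase m) m + 1
      ≤ potential k δ (run μ δ N x n).phase (run μ δ N x n).threshold := by
  have hinv := h.roundInv
  have hsum := h.sum_counter
  cases hs : (run μ δ N x n).phase
  · have hq := hc.2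
    simp only [RoundInv, hs, quota] at hinv hq
    omega
  · have hdrop := hinv.four_mul_sub_le hs hc
    rw [hsum, ← hmT] at hdrop
    simp only [RoundInv, hs] at hinv
    exact potential_nextPhase_cmy_add_one_le (pos_of_log_div_pos hL) hinv.1 hm hdrop
  · have hlt := h.target_lt hs hc (hg hs)
    simp only [RoundInv, hs] at hinv
    refine potential_nextPhase_staticSlack_add_one_le hL hinv.1 hm ?_
    rw [hmT, Nat.cast_sub (by omega)]
    linarith
  · exact absurd hs hinv.phase_ne_alarm

lemma InRound.rounds_finish_add_potential_le (hL : 0 < Real.log (k / δ))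
    (h : InRound μ δ N x a n) (hc : Completes μ δ (run μ δ N x n) (x n))
    (hg : (run μ δ N x n).phase = .staticSlack → GoodFrom μ δ N x a) :
    (finish δ (run μ δ N x n)).rounds
        + potential k δ (finish δ (run μ δ N x n)).phase (finish δ (run μ δ N x n)).threshold
      ≤ (run μ δ N x n).rounds
        + potential k δ (run μ δ N x n).phase (run μ δ N x n).threshold := by
  simp only [finish, startRound, h.sum_counter]
  obtain ⟨m, hm⟩ : ∃ m, m = (run μ δ N x n).threshold - (n - a + 1) := ⟨_, rfl⟩
  rw [← hm]
  rcases Nat.eq_zero_or_pos m with rfl | hpos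
  · simpa [nextPhase_eq_alarm_iff.mpr, potential] using h.roundInv.potential_nonneg hL
  · rw [if_neg hpos.ne']
    push_cast
    linarith [h.potential_nextPhase_add_one_le hL hc hg hpos hm]

theorem rounds_add_potential_le (hL : 0 < Real.log (k / δ)) (hμ : μ ∈ stdSimplex ℝ (Fin k))
    (hN : 0 < N) (hR : potential k δ (nextPhase k δ .staticSlack N) N ≤ tailRounds k δ + R)
    (hgood : EarlyRoundsGood μ δ N R x) (n : ℕ) :
    (run μ δ N x n).rounds + potential k δ (run μ δ N x n).phase (run μ δ N x n).threshold
      ≤ 1 + potential k δ (nextPhase k δ .staticSlack N) N := by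
  induction n with
  | zero => simp [run, startRound, hN.ne']
  | succ n ih =>
    rcases alarm_or_inRound hL hμ hN x n with ⟨hs, -⟩ | ⟨a, h⟩
    · rwa [run, step_of_phase_eq_alarm hs]
    by_cases hc : Completes μ δ (run μ δ N x n) (x n)
    · rw [run, step_of_completes hc]
      refine (h.rounds_finish_add_potential_le hL hc fun hs => ?_).trans ih
      have hinv := h.roundInv
      simp only [RoundInv, hs] at hinv
      rw [hs] at ih
      have hpot := tailRounds_add_one_le_potential hL hinv.1
      have hrounds : ((run μ δ N x n).rounds : ℝ) ≤ R := by linarith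
      refine hgood a (h.start_le.trans_lt (h.lt hL hμ))
        ⟨h.phase_start.trans hs, h.counter_start, ?_⟩
      rw [h.rounds_start]
      exact_mod_cast hrounds
    · rwa [run, step_of_not_completes h.roundInv.phase_ne_alarm hc]

theorem rounds_le_one_add_potential (hL : 0 < Real.log (k / δ)) (hμ : μ ∈ stdSimplex ℝ (Fin k))
    (hN : 0 < N) (hR : potential k δ (nextPhase k δ .staticSlack N) N ≤ tailRounds k δ + R)
    (hgood : EarlyRoundsGood μ δ N R x) :
    (run μ δ N x N).rounds ≤ 1 + potential k δ (nextPhase k δ .staticSlack N) N := by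
  have h := rounds_add_potential_le hL hμ hN hR hgood N
  rw [(run_phase_eq_alarm_iff hL hμ hN x N).mpr le_rfl] at h
  simpa only [potential, add_zero] using h

lemma monotone_rounds (μ : Fin k → ℝ) (δ : ℝ) (N : ℕ) (x : ℕ → Fin k) :
    Monotone fun n => (run μ δ N x n).rounds := by
  refine monotone_nat_of_le_succ fun n => ?_
  rw [run]
  by_cases hs : (run μ δ N x n).phase = .alarm
  · rw [step_of_phase_eq_alarm hs]
  by_cases hc : Completes μ δ (run μ δ N x n) (x n)
  · rw [step_of_completes hc]
    simp only [finish, startRound]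
    split_ifs <;> omega
  · rw [step_of_not_completes hs hc]
    rfl

lemma EarlyStaticStart.rounds_lt (h : EarlyStaticStart μ δ N R x (n + 1)) :
    (run μ δ N x n).rounds < (run μ δ N x (n + 1)).rounds := by
  obtain ⟨hphase, hcounter, -⟩ := h
  rw [run] at hphase hcounter ⊢
  by_cases hs : (run μ δ N x n).phase = .alarm
  · simp [step_of_phase_eq_alarm hs, hs] at hphase
  by_cases hc : Completes μ δ (run μ δ N x n) (x n)
  · rw [step_of_completes hc] at hphase ⊢
    simp only [finish, startRound] at hphase ⊢
    split_ifs with h0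
    · simp [nextPhase_eq_alarm_iff.mpr h0] at hphase
    · exact Nat.lt_succ_self _
  · rw [step_of_not_completes hs hc] at hcounter
    simpa [advance, bump_apply] using congrFun hcounter (x n)

open Classical in
lemma card_earlyStaticStart_le (μ : Fin k → ℝ) (δ : ℝ) (hN : 0 < N) (R : ℕ) (x : ℕ → Fin k)
    (n : ℕ) : #{a ∈ range n | EarlyStaticStart μ δ N R x a} ≤ R := by
  have hmono := monotone_rounds μ δ N x
  have hpos (a : ℕ) : 1 ≤ (run μ δ N x a).rounds := by
    refine le_trans ?_ (hmono a.zero_le)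
    simp [run, startRound, hN.ne']
  have hlt {a b : ℕ} (hb : EarlyStaticStart μ δ N R x b) (hab : a < b) :
      (run μ δ N x a).rounds < (run μ δ N x b).rounds := by
    obtain ⟨c, rfl⟩ := Nat.exists_eq_succ_of_ne_zero hab.ne_bot
    exact (hmono (Nat.le_of_lt_succ hab)).trans_lt hb.rounds_lt
  calc #{a ∈ range n | EarlyStaticStart μ δ N R x a} ≤ #(Icc 1 R) := by
        refine card_le_card_of_injOn (fun a => (run μ δ N x a).rounds) ?_ ?_
        · exact fun a ha => mem_coe.mpr (mem_Icc.mpr ⟨hpos a, (mem_filter.mp ha).2.2.2⟩)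
        · intro a ha b hb hab
          rcases lt_trichotomy a b with h | h | h
          · exact absurd hab (hlt (mem_filter.mp hb).2 h).ne
          · exact h
          · exact absurd hab (hlt (mem_filter.mp ha).2 h).ne'
    _ = R := Nat.card_Icc 1 R

end Rounds

section LogLog

variable {k N : ℕ} {δ : ℝ}

lemma one_le_logLog (x : ℝ) : 1 ≤ logLog x := le_max_left _ _

lemma logLog_mono {x y : ℝ} (hx : 0 < x) (hxy : x ≤ y) : logLog x ≤ logLog y := by
  unfold logLog
  gcongr

lemma log_mul_log_le {c x : ℝ} (hc : 0 < c) (hx : 0 < Real.log x) :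
    Real.log (c * Real.log x) ≤ Real.log c + logLog x := by
  rw [Real.log_mul hc.ne' hx.ne']
  gcongr
  exact (Real.log_le_log hx (le_max_right _ _)).trans (le_max_right _ _)

lemma logb_logb_two_le {x : ℝ} (hx : 1 < x) :
    Real.logb 2 (Real.logb 2 x) ≤ 2 * (1 + logLog x) := by
  have hlog2 : 1 / 2 ≤ Real.log 2 := by linarith [Real.log_two_gt_d9]
  have hlogx := Real.log_pos hx
  have hle : Real.log (Real.logb 2 x) ≤ 1 + logLog x := by
    calc Real.log (Real.logb 2 x) = Real.log ((Real.log 2)⁻¹ * Real.log x) := by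
          rw [Real.logb, div_eq_inv_mul]
      _ ≤ Real.log (Real.log 2)⁻¹ + logLog x := log_mul_log_le (by positivity) hlogx
      _ ≤ 1 + logLog x := by
          gcongr
          have hinv : (Real.log 2)⁻¹ ≤ 2 := inv_le_of_inv_le₀ two_pos (by simpa using hlog2)
          linarith [Real.log_le_sub_one_of_pos (x := (Real.log 2)⁻¹) (by positivity)]
  rw [Real.logb, div_le_iff₀ (by linarith)]
  nlinarith [one_le_logLog x]

lemma tailRounds_le (hL : 0 < Real.log (k / δ)) : tailRounds k δ ≤ 11 * logLog (k / δ) := by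
  have hQ := one_le_logLog (k / δ)
  have hlog : 1 / 4 ≤ Real.log (4 / 3) := by
    linarith [Real.one_sub_inv_le_log_of_pos (x := 4 / 3) (by norm_num)]
  have hβ := beta_pos
  have hle : Real.log (beta * Real.log (k / δ) / 4) ≤ 3 / 2 + logLog (k / δ) := by
    rw [mul_div_right_comm]
    linarith [log_mul_log_le (c := beta / 4) (by positivity) hL, beta_le_ten,
      Real.log_le_sub_one_of_pos (x := beta / 4) (by positivity)]
  have hlogb : Real.logb (4 / 3) (beta * Real.log (k / δ) / 4) ≤ 4 * (3 / 2 + logLog (k / δ)) := by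
    rw [Real.logb, div_le_iff₀ (by linarith)]
    nlinarith
  have hmax : max 0 (Real.logb (4 / 3) (beta * Real.log (k / δ) / 4))
      ≤ 4 * (3 / 2 + logLog (k / δ)) := max_le (by linarith) hlogb
  unfold tailRounds
  linarith

lemma normalizedThreshold_le (hL : 0 < Real.log (k / δ)) :
    normalizedThreshold k δ N ≤ N / (k * Real.log (k / δ)) := by
  have hk := pos_of_log_div_pos hL
  have hkL : 0 < k * Real.log (k / δ) := by positivity
  refine div_le_div_of_nonneg_left N.cast_nonneg hkL (le_mul_of_one_le_left hkL.le ?_)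
  linarith [four_lt_slackConst_sq]

lemma potential_nextPhase_staticSlack_le (hN : 0 < N) (hL : 0 < Real.log (k / δ)) :
    potential k δ (nextPhase k δ .staticSlack N) N
      ≤ tailRounds k δ + 5 * logLog (N / (k * Real.log (k / δ))) := by
  have hP := one_le_logLog (N / (k * Real.log (k / δ)))
  rcases nextPhase_staticSlack_cases (k := k) (δ := δ) hN with htail | ⟨hnext, hN'⟩
  · linarith
  · have hy := two_lt_normalizedThreshold hL hN'
    have hloglog := logb_logb_two_le (one_lt_two.trans hy)
    have := logLog_mono (by linarith) (normalizedThreshold_le hL (N := N))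
    rw [hnext]
    simp only [potential]
    linarith

lemma logLog_div_le (hk : 0 < k) (hN : 0 < N) (h0 : 0 < δ) (h : 3 * δ ≤ 1) :
    logLog (N / (k * Real.log (k / δ))) ≤ logLog N := by
  have hk1 : (1 : ℝ) ≤ k := by exact_mod_cast hk
  have hlog : 1 ≤ Real.log (k / δ) := by
    rw [Real.le_log_iff_exp_le (by positivity), le_div_iff₀ h0]
    nlinarith [Real.exp_one_lt_d9]
  exact logLog_mono (by positivity)
    (div_le_self N.cast_nonneg (one_le_mul_of_one_le_of_one_le hk1 hlog))

end LogLog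

section Cost

variable {k N R : ℕ} {μ : Fin k → ℝ} {δ : ℝ}

/-- The number of rounds that are required to be good, if they are static-slack rounds. -/
noncomputable def earlyRounds (k : ℕ) (δ : ℝ) (N : ℕ) : ℕ :=
  ⌈5 * logLog (N / (k * Real.log (k / δ)))⌉₊

lemma earlyRounds_le (k : ℕ) (δ : ℝ) (N : ℕ) :
    earlyRounds k δ N ≤ 6 * logLog (N / (k * Real.log (k / δ))) := by
  have h := one_le_logLog (N / (k * Real.log (k / δ)))
  have := Nat.ceil_lt_add_one (a := 5 * logLog (N / (k * Real.log (k / δ)))) (by positivity)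
  unfold earlyRounds
  linarith

theorem rounds_le_of_earlyRoundsGood (hL : 0 < Real.log (k / δ)) (hμ : μ ∈ stdSimplex ℝ (Fin k))
    (hN : 0 < N) {x : ℕ → Fin k} (hgood : EarlyRoundsGood μ δ N (earlyRounds k δ N) x) :
    (run μ δ N x N).rounds ≤ 12 * (logLog (N / (k * Real.log (k / δ))) + logLog (k / δ)) := by
  have hpot := potential_nextPhase_staticSlack_le hN hL
  have hR := hpot.trans (add_le_add_right (Nat.le_ceil _) (tailRounds k δ))
  linarith [rounds_le_one_add_potential hL hμ hN hR hgood, tailRounds_le hL, one_le_logLog (k / δ),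
    one_le_logLog (N / (k * Real.log (k / δ)))]

theorem cost_le_of_earlyRoundsGood (hL : 0 < Real.log (k / δ)) (hμ : μ ∈ stdSimplex ℝ (Fin k))
    (hN : 0 < N) {x : ℕ → Fin k} (hgood : EarlyRoundsGood μ δ N (earlyRounds k δ N) x) :
    (run μ δ N x N).rounds ≤ 60 * (logLog (N / (k * Real.log (k / δ))) + logLog (k / δ)) ∧
    (run μ δ N x N).messages
      ≤ 60 * (k * logLog (N / (k * Real.log (k / δ))) + k * logLog (k / δ)) := by
  have hrounds := rounds_le_of_earlyRoundsGood hL hμ hN hgood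
  have hmessages : ((run μ δ N x N).messages : ℝ) ≤ 5 * k * (run μ δ N x N).rounds := by
    exact_mod_cast messages_le_mul_rounds hL hμ hN x
  constructor
  · linarith [one_le_logLog (k / δ), one_le_logLog (N / (k * Real.log (k / δ)))]
  · linarith [mul_le_mul_of_nonneg_left hrounds (by positivity : (0 : ℝ) ≤ 5 * k)]

lemma EarlyStaticStart.lt (hL : 0 < Real.log (k / δ)) (hμ : μ ∈ stdSimplex ℝ (Fin k)) (hN : 0 < N)
    {x : ℕ → Fin k} {a : ℕ} (h : EarlyStaticStart μ δ N R x a) :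
    beta * k * Real.log (k / δ) < (N - a : ℕ) := by
  obtain ⟨hphase, hcounter, -⟩ := h
  rcases alarm_or_inRound hL hμ hN x a with ⟨hs, -⟩ | ⟨b, h⟩
  · simp [hphase] at hs
  have hinv := h.roundInv
  have hsum := h.sum_counter
  have hba := h.start_le
  have hT := h.start_add_threshold
  simp only [RoundInv, hphase] at hinv
  simp only [hcounter, Pi.zero_apply, sum_const_zero] at hsum
  rw [show N - a = (run μ δ N x a).threshold by omega]
  exact hinv.1

lemma dependsOn_run (μ : Fin k → ℝ) (δ : ℝ) (N n : ℕ) :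
    DependsOn (fun x => run μ δ N x n) (range n : Set ℕ) := by
  intro x y hxy
  induction n with
  | zero => rfl
  | succ n ih =>
    have hrun : run μ δ N x n = run μ δ N y n := ih fun j hj => hxy j (by simp at hj ⊢; omega)
    simp only [run, hrun, hxy n (by simp)]

lemma dependsOn_earlyStaticStart (μ : Fin k → ℝ) (δ : ℝ) (N R a : ℕ) :
    DependsOn (fun x => EarlyStaticStart μ δ N R x a) (range a : Set ℕ) := by
  intro x y hxy
  have hrun : run μ δ N x a = run μ δ N y a := dependsOn_run μ δ N a hxy
  simp only [EarlyStaticStart, hrun]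

lemma dependsOn_goodFrom (μ : Fin k → ℝ) (δ : ℝ) (N a : ℕ) :
    DependsOn (fun x => GoodFrom μ δ N x a) (Ico a (a + ⌊target k δ (N - a)⌋₊) : Set ℕ) := by
  intro x y hxy
  have hcount := dependsOn_itemCount a (a + ⌊target k δ (N - a)⌋₊) hxy
  simp only [GoodFrom, hcount]

variable {Ω : Type*} [MeasurableSpace Ω] {P : Measure Ω} [IsProbabilityMeasure P]
  {X : ℕ → Ω → Fin k}

lemma measureReal_not_goodFrom_le {a : ℕ} (h0 : 0 < δ) (hL : 0 < Real.log (k / δ))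
    (hX : ∀ j, Measurable (X j)) (hindep : iIndepFun X P)
    (hlaw : ∀ j i, P.real {ω | X j ω = i} = μ i)
    (ha : beta * k * Real.log (k / δ) < (N - a : ℕ)) :
    P.real {ω | ¬ GoodFrom μ δ N (fun j => X j ω) a} ≤ δ := by
  have hk := pos_of_log_div_pos hL
  have ht := target_pos hL ha
  set b := a + ⌊target k δ (N - a)⌋₊ with hb
  have hplayer (i : Fin k) :
      P.real {ω | slack μ δ (N - a) i ≤ itemCount (fun j => X j ω) a b i} ≤ δ / k := by
    calc P.real {ω | slack μ δ (N - a) i ≤ itemCount (fun j => X j ω) a b i}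
        ≤ Real.exp (-Real.log (k / δ)) := by
          have hcard : (#(Ico a b) : ℝ) ≤ target k δ (N - a) := by
            simpa [hb] using Nat.floor_le ht.le
          convert measureReal_card_filter_ge_le_exp hindep hX (hlaw · i) (Ico a b) hcard hL using 4
          simp only [slack, ← mul_assoc, itemCount]
      _ = δ / k := by rw [Real.exp_neg, Real.exp_log (by positivity), inv_div]
  calc P.real {ω | ¬ GoodFrom μ δ N (fun j => X j ω) a}
      = P.real (⋃ i, {ω | slack μ δ (N - a) i ≤ itemCount (fun j => X j ω) a b i}) := by
        congr 1
        ext ω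
        simp [GoodFrom, hb]
    _ ≤ ∑ i, P.real {ω | slack μ δ (N - a) i ≤ itemCount (fun j => X j ω) a b i} :=
        measureReal_iUnion_fintype_le _
    _ ≤ ∑ _ : Fin k, δ / k := sum_le_sum fun i _ => hplayer i
    _ = δ := by
        rw [sum_const, card_univ, Fintype.card_fin, nsmul_eq_mul]
        field_simp

theorem measureReal_not_earlyRoundsGood_le (h0 : 0 < δ) (hL : 0 < Real.log (k / δ))
    (hμ : μ ∈ stdSimplex ℝ (Fin k)) (hN : 0 < N) (hX : ∀ j, Measurable (X j))
    (hindep : iIndepFun X P) (hlaw : ∀ j i, P.real {ω | X j ω = i} = μ i) (R : ℕ) :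
    P.real {ω | ¬ EarlyRoundsGood μ δ N R fun j => X j ω} ≤ δ * R := by
  let A (a : ℕ) : Set Ω := {ω | EarlyStaticStart μ δ N R (fun j => X j ω) a}
  let B (a : ℕ) : Set Ω := {ω | ¬ GoodFrom μ δ N (fun j => X j ω) a}
  have hset : {ω | ¬ EarlyRoundsGood μ δ N R fun j => X j ω} = ⋃ a ∈ range N, A a ∩ B a := by
    ext ω
    simp [EarlyRoundsGood, A, B, and_left_comm]
  rw [hset]
  refine measureReal_biUnion_inter_le h0.le
    (fun a _ => measurableSet_of_dependsOn hX (dependsOn_earlyStaticStart μ δ N R a))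
    (fun ω => card_earlyStaticStart_le μ δ hN R (fun j => X j ω) N) fun a _ => ?_
  have hdisj : Disjoint (range a) (Ico a (a + ⌊target k δ (N - a)⌋₊)) := by
    rw [range_eq_Ico]
    exact Ico_disjoint_Ico_consecutive _ _ _
  have hindepAB : P.real (A a ∩ B a) = P.real (A a) * P.real (B a) :=
    measureReal_and_of_dependsOn hindep hX hdisj (dependsOn_earlyStaticStart μ δ N R a)
      fun x y hxy => congrArg Not (dependsOn_goodFrom μ δ N a hxy)
  rw [hindepAB, mul_comm]
  rcases (A a).eq_empty_or_nonempty with hA | ⟨ω, hω⟩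
  · simp [hA]
  · gcongr
    exact measureReal_not_goodFrom_le h0 hL hX hindep hlaw (hω.lt hL hμ hN)

theorem measureReal_not_earlyRoundsGood_le_logLog (h0 : 0 < δ) (hL : 0 < Real.log (k / δ))
    (hμ : μ ∈ stdSimplex ℝ (Fin k)) (hN : 0 < N) (hX : ∀ j, Measurable (X j))
    (hindep : iIndepFun X P) (hlaw : ∀ j i, P.real {ω | X j ω = i} = μ i) :
    P.real {ω | ¬ EarlyRoundsGood μ δ N (earlyRounds k δ N) fun j => X j ω}
      ≤ δ * (60 * logLog N) := by
  have hone := one_le_logLog N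
  -- If `3 * δ > 1`, the claimed failure probability is at least `1`.
  rcases le_total (3 * δ) 1 with hδ | hδ
  · have := logLog_div_le (pos_of_log_div_pos hL) hN h0 hδ
    refine (measureReal_not_earlyRoundsGood_le h0 hL hμ hN hX hindep hlaw _).trans ?_
    gcongr
    linarith [earlyRounds_le k δ N]
  · exact measureReal_le_one.trans (by nlinarith)

end Cost

end DistTracking

theorem mainTheorem1 :
    ∃ C : ℝ, 0 < C ∧
      ∀ (k N : ℕ) (δ : ℝ) (μ : Fin k → ℝ),
        0 < k → 0 < N → 0 < δ → δ < 1 → (∀ i, 0 ≤ μ i) → ∑ i, μ i = 1 →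
        -- on every input stream the alarm is raised exactly at the arrival of item number `N`
        (∀ (x : ℕ → Fin k) (n : ℕ),
          (DistTracking.run μ δ N x n).phase = DistTracking.Phase.alarm ↔ N ≤ n) ∧
        -- the number of rounds and of messages of the whole run, for independent items
        ∀ (Ω : Type*) [MeasurableSpace Ω] (P : Measure Ω) [IsProbabilityMeasure P]
          (X : ℕ → Ω → Fin k),
          (∀ j, Measurable (X j)) → iIndepFun X P →
          (∀ j i, P.real {ω | X j ω = i} = μ i) →
          1 - δ * (C * DistTracking.logLog N) ≤
            P.real {ω |
              ((DistTracking.run μ δ N (fun j => X j ω) N).rounds : ℝ) ≤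
                C * (DistTracking.logLog (N / (k * Real.log (k / δ)))
                  + DistTracking.logLog (k / δ)) ∧
              ((DistTracking.run μ δ N (fun j => X j ω) N).messages : ℝ) ≤
                C * (k * DistTracking.logLog (N / (k * Real.log (k / δ)))
                  + k * DistTracking.logLog (k / δ))} := by
  refine ⟨60, by norm_num, fun k N δ μ hk hN h0 h1 hμ hsum => ?_⟩
  have hL := DistTracking.log_div_pos hk h0 h1
  have hsimplex : μ ∈ stdSimplex ℝ (Fin k) := ⟨hμ, hsum⟩
  refine ⟨DistTracking.run_phase_eq_alarm_iff hL hsimplex hN, ?_⟩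
  intro Ω _ P _ X hX hindep hlaw
  have hbad := DistTracking.measureReal_not_earlyRoundsGood_le_logLog h0 hL hsimplex hN hX hindep
    hlaw
  rw [sub_le_iff_le_add, ← probReal_univ (μ := P)]
  refine (measureReal_mono fun ω _ => ?_).trans
    ((measureReal_union_le _ _).trans (add_le_add_right hbad _))
  by_cases hgood : DistTracking.EarlyRoundsGood μ δ N (DistTracking.earlyRounds k δ N)
    fun j => X j ω
  · exact .inl (DistTracking.cost_le_of_earlyRoundsGood hL hsimplex hN hgood)
  · exact .inr hgood
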